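/- Let $X$ and $Y$ be complex Banach spaces and let $S\in L(X)$, $T\in L(Y)$ be bounded linear operators. For a bounded linear operator $R$ on a complex Banach space put $\alpha(R)=\dim\ker R$ and let $\beta(R)$ be the codimension of the range of $R$. Call $R$ upper semi-Weyl if its range is closed, $\alpha(R)<\infty$ and $\operatorname{ind}R=\alpha(R)-\beta(R)\le 0$ (the value $-\infty$ being allowed). Let $\sigma(R)$ be the spectrum of $R$, let $\sigma_{uw}(R)$ be the set of $\lambda\in\mathbb C$ such that $R-\lambda I$ is not upper semi-Weyl, let $\sigma_a(R)$ be the approximate point spectrum (the set of $\lambda$ such that $R-\lambda I$ is not bounded below), and let $\pi_{00}^a(R)$ be the set of isolated points $\lambda$ of $\sigma_a(R)$ that are eigenvalues of $R$ with $\alpha(R-\lambda I)<\infty$. The operator $R$ satisfies property $(z)$ if $\sigma(R)\setminus\sigma_{uw}(R)=\pi_{00}^a(R)$. It has the single valued extension property (SVEP) if for every open $U\subseteq\mathbb C$ the only analytic function $f$ on $U$, with values in the space on which $R$ acts, such that $(R-\lambda I)f(\lambda)=0$ for all $\lambda\in U$ is $f\equiv 0$. The operators $S$ and $T$ are quasisimilar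 if there are injective bounded linear operators with dense range $A:X\to Y$ and $B:Y\to X$ such that $AS=TA$ and $BT=SB$. If $S$ and $T$ are quasisimilar, both satisfy property $(z)$, and at least one of them has SVEP, then the direct sum $S\oplus T$ on $X\oplus Y$ satisfies property $(z)$. -/

import Mathlib

open Topology Filter
open scoped ENNReal

namespace BanachOp

variable {X Y : Type*} [NormedAddCommGroup X] [NormedSpace ℂ X]
  [NormedAddCommGroup Y] [NormedSpace ℂ Y]

/-- The operator `T - λ I`. -/
def shift (T : X →L[ℂ] X) (z : ℂ) : X →L[ℂ] X :=
  T - z • ContinuousLinearMap.id ℂ X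

/-- `α(T)`: the dimension of the kernel, `⊤` if it is infinite. -/
noncomputable def nullity (T : X →L[ℂ] X) : ℕ∞ :=
  Cardinal.toENat (Module.rank ℂ (LinearMap.ker (T : X →ₗ[ℂ] X)))

/-- `β(T)`: the codimension of the range, `⊤` if it is infinite. -/
noncomputable def defect (T : X →L[ℂ] X) : ℕ∞ :=
  Cardinal.toENat (Module.rank ℂ (X ⧸ LinearMap.range (T : X →ₗ[ℂ] X)))

/-- Upper semi-Fredholm: closed range and finite-dimensional kernel. -/
def IsUpperSemiFredholm (T : X →L[ℂ] X) : Prop :=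
  IsClosed (Set.range T) ∧ nullity T < ⊤

/-- The index `α(T) - β(T)`, with values in the extended reals. It is used only for
semi-Fredholm operators, where at most one of the two terms is infinite. -/
noncomputable def index (T : X →L[ℂ] X) : EReal :=
  (((nullity T : ℕ∞) : ℝ≥0∞) : EReal) - (((defect T : ℕ∞) : ℝ≥0∞) : EReal)

/-- Upper semi-Weyl: upper semi-Fredholm of index `≤ 0`. -/
def IsUpperSemiWeyl (T : X →L[ℂ] X) : Prop :=
  IsUpperSemiFredholm T ∧ index T ≤ 0

/-- `σ_uw(T)`: the upper semi-Weyl spectrum. -/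
def upperSemiWeylSpectrum (T : X →L[ℂ] X) : Set ℂ :=
  {z | ¬ IsUpperSemiWeyl (shift T z)}

/-- `σ_a(T)`: the approximate point spectrum, i.e. all `λ` for which there are unit vectors `x`
with `‖(T - λ I) x‖` arbitrarily small (`T - λ I` is not bounded below). -/
def approxPointSpectrum (T : X →L[ℂ] X) : Set ℂ :=
  {z | ∀ ε : ℝ, 0 < ε → ∃ x : X, ‖x‖ = 1 ∧ ‖shift T z x‖ < ε}

/-- `iso A`: the isolated points of `A`, i.e. points of `A` that are not accumulation points. -/
def iso (A : Set ℂ) : Set ℂ :=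
  A \ derivedSet A

/-- `σ_p⁰(T)`: the eigenvalues of `T` of finite multiplicity, the multiplicity of `λ` being
`α(T - λ I)`. -/
def finiteEigenvalues (T : X →L[ℂ] X) : Set ℂ :=
  {z | Module.End.HasEigenvalue (T : X →ₗ[ℂ] X) z ∧ nullity (shift T z) < ⊤}

/-- `π₀₀ᵃ(T) = iso σ_a(T) ∩ σ_p⁰(T)`. -/
def piA00 (T : X →L[ℂ] X) : Set ℂ :=
  iso (approxPointSpectrum T) ∩ finiteEigenvalues T

/-- Property `(z)`: `σ(T) \ σ_uw(T) = π₀₀ᵃ(T)`. -/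
def PropertyZ (T : X →L[ℂ] X) : Prop :=
  spectrum ℂ T \ upperSemiWeylSpectrum T = piA00 T

/-- The single valued extension property at `z₀`: for every open neighbourhood `U` of `z₀`, the
only analytic `f : U → X` with `(T - λ I) f(λ) = 0` for all `λ ∈ U` is `f ≡ 0`. -/
def HasSVEPAt (T : X →L[ℂ] X) (z₀ : ℂ) : Prop :=
  ∀ U : Set ℂ, IsOpen U → z₀ ∈ U → ∀ f : ℂ → X, AnalyticOnNhd ℂ f U →
    (∀ z ∈ U, shift T z (f z) = 0) → ∀ z ∈ U, f z = 0

/-- The single valued extension property (at every point of `ℂ`). -/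
def HasSVEP (T : X →L[ℂ] X) : Prop :=
  ∀ z₀ : ℂ, HasSVEPAt T z₀

/-- Quasi-invertible: injective with dense range. -/
def IsQuasiInvertible (A : X →L[ℂ] Y) : Prop :=
  Function.Injective A ∧ DenseRange A

/-- `T ∈ L(X)` and `S ∈ L(Y)` are quasisimilar: `A T = S A` and `B S = T B` for some
quasi-invertible `A ∈ L(X, Y)` and `B ∈ L(Y, X)`. -/
def Quasisimilar (T : X →L[ℂ] X) (S : Y →L[ℂ] Y) : Prop :=
  ∃ (A : X →L[ℂ] Y) (B : Y →L[ℂ] X), IsQuasiInvertible A ∧ IsQuasiInvertible B ∧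
    A ∘L T = S ∘L A ∧ B ∘L S = T ∘L B

/-- The direct sum `S ⊕ T` on `X × Y`, `(x, y) ↦ (S x, T y)`. -/
def directSum (S : X →L[ℂ] X) (T : Y →L[ℂ] Y) : (X × Y) →L[ℂ] (X × Y) :=
  S.prodMap T

end BanachOp

/-! Injective intertwiners carry kernels into kernels, so quasisimilar operators share their
eigenvalues and nullities; dense range gives equal defects as well once both ranges are closed.
Hence both sides of property $(z)$ for $S\oplus T$ become intersections. The sum minus $\lambda$ is
upper semi-Weyl iff both summands are. An eigenvalue lies in both approximate point spectra, so it
is isolated in their union iff it is isolated in each. Finally, property $(z)$ turns spectral points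
outside $\sigma_{uw}$ into eigenvalues, which are common, so the two spectra agree outside both
upper semi-Weyl spectra. -/

theorem toENat_rank_le_of_injective {V W : Type*} [AddCommGroup V] [Module ℂ V]
    [AddCommGroup W] [Module ℂ W] (f : V →ₗ[ℂ] W) (hf : Function.Injective f) :
    Cardinal.toENat (Module.rank ℂ V) ≤ Cardinal.toENat (Module.rank ℂ W) := by
  -- The ranks live in different universes; `Cardinal.toENat` absorbs the lifts.
  have h := OrderHomClass.mono Cardinal.toENat (LinearMap.lift_rank_le_of_injective f hf)
  simpa only [Cardinal.toENat_lift] using h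

theorem toENat_rank_le_of_surjective {V W : Type*} [AddCommGroup V] [Module ℂ V]
    [AddCommGroup W] [Module ℂ W] (f : V →ₗ[ℂ] W) (hf : Function.Surjective f) :
    Cardinal.toENat (Module.rank ℂ W) ≤ Cardinal.toENat (Module.rank ℂ V) := by
  obtain ⟨g, hg⟩ := f.exists_rightInverse_of_surjective (LinearMap.range_eq_top.2 hf)
  refine toENat_rank_le_of_injective g fun x y h => ?_
  simpa only [← LinearMap.comp_apply, hg, LinearMap.id_apply] using congrArg f h

theorem toENat_rank_eq {V W : Type*} [AddCommGroup V] [Module ℂ V]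
    [AddCommGroup W] [Module ℂ W] (e : V ≃ₗ[ℂ] W) :
    Cardinal.toENat (Module.rank ℂ V) = Cardinal.toENat (Module.rank ℂ W) :=
  le_antisymm (toENat_rank_le_of_injective e.toLinearMap e.injective)
    (toENat_rank_le_of_injective e.symm.toLinearMap e.symm.injective)

theorem toENat_rank_prod (V W : Type*) [AddCommGroup V] [Module ℂ V]
    [AddCommGroup W] [Module ℂ W] :
    Cardinal.toENat (Module.rank ℂ (V × W)) =
      Cardinal.toENat (Module.rank ℂ V) + Cardinal.toENat (Module.rank ℂ W) := by
  rw [rank_prod, map_add, Cardinal.toENat_lift, Cardinal.toENat_lift]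

namespace BanachOp

variable {X Y : Type*} [NormedAddCommGroup X] [NormedSpace ℂ X]
  [NormedAddCommGroup Y] [NormedSpace ℂ Y]

/-! ### Kernel, range and index of a direct sum -/

theorem shift_directSum (S : X →L[ℂ] X) (T : Y →L[ℂ] Y) (z : ℂ) :
    shift (directSum S T) z = directSum (shift S z) (shift T z) := by
  ext p <;> simp [shift, directSum]

theorem nullity_directSum (S : X →L[ℂ] X) (T : Y →L[ℂ] Y) :
    nullity (directSum S T) = nullity S + nullity T := by
  rw [nullity, nullity, nullity, ← toENat_rank_prod]
  have h : LinearMap.ker (directSum S T : X × Y →ₗ[ℂ] X × Y) =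
      (LinearMap.ker (S : X →ₗ[ℂ] X)).prod (LinearMap.ker (T : Y →ₗ[ℂ] Y)) :=
    LinearMap.ker_prodMap _ _
  rw [h]
  exact toENat_rank_eq
    { toFun := fun v => (⟨v.1.1, v.2.1⟩, ⟨v.1.2, v.2.2⟩)
      invFun := fun v => ⟨(v.1.1, v.2.1), v.1.2, v.2.2⟩
      map_add' := fun _ _ => rfl
      map_smul' := fun _ _ => rfl }

theorem defect_directSum (S : X →L[ℂ] X) (T : Y →L[ℂ] Y) :
    defect (directSum S T) = defect S + defect T := by
  rw [defect, defect, defect, ← toENat_rank_prod]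
  set p := LinearMap.range (S : X →ₗ[ℂ] X)
  set q := LinearMap.range (T : Y →ₗ[ℂ] Y)
  -- As the kernel of a surjection, the range has an immediate quotient.
  have h : LinearMap.range (directSum S T : X × Y →ₗ[ℂ] X × Y) =
      LinearMap.ker (p.mkQ.prodMap q.mkQ) := by
    rw [LinearMap.ker_prodMap, p.ker_mkQ, q.ker_mkQ]
    exact LinearMap.range_prodMap _ _
  rw [h]
  exact toENat_rank_eq (LinearMap.quotKerEquivOfSurjective _
    (Function.Surjective.prodMap p.mkQ_surjective q.mkQ_surjective))

theorem isClosed_range_directSum (S : X →L[ℂ] X) (T : Y →L[ℂ] Y) :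
    IsClosed (Set.range (directSum S T)) ↔
      IsClosed (Set.range S) ∧ IsClosed (Set.range T) := by
  have h : Set.range (directSum S T) = Set.range S ×ˢ Set.range T := Set.range_prodMap
  rw [h]
  refine ⟨fun hc => ⟨?_, ?_⟩, fun hc => hc.1.prod hc.2⟩
  -- Each range is a slice of the product through zero.
  · convert hc.preimage (f := fun x : X => (x, (0 : Y))) (by fun_prop)
    ext x
    have : ∃ y, T y = 0 := ⟨0, map_zero T⟩
    simp [this]
  · convert hc.preimage (f := fun y : Y => ((0 : X), y)) (by fun_prop)
    ext x
    have : ∃ y, S y = 0 := ⟨0, map_zero S⟩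
    simp [this]

theorem isUpperSemiFredholm_directSum (S : X →L[ℂ] X) (T : Y →L[ℂ] Y) :
    IsUpperSemiFredholm (directSum S T) ↔ IsUpperSemiFredholm S ∧ IsUpperSemiFredholm T := by
  rw [IsUpperSemiFredholm, IsUpperSemiFredholm, IsUpperSemiFredholm, isClosed_range_directSum,
    nullity_directSum, ENat.add_lt_top]
  tauto

/-- No finiteness is needed: `⊤ - ⊤ = ⊥` in `EReal`, in agreement with `⊤ ≤ ⊤`. -/
theorem index_nonpos_iff (T : X →L[ℂ] X) : index T ≤ 0 ↔ nullity T ≤ defect T := by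
  rw [index, EReal.sub_nonpos, EReal.coe_ennreal_le_coe_ennreal_iff, ENat.toENNReal_le]

theorem isUpperSemiWeyl_iff (T : X →L[ℂ] X) :
    IsUpperSemiWeyl T ↔ IsUpperSemiFredholm T ∧ nullity T ≤ defect T :=
  and_congr_right fun _ => index_nonpos_iff T

/-! ### Transfer along intertwining operators -/

theorem shift_intertwines {S : X →L[ℂ] X} {T : Y →L[ℂ] Y} {A : X →L[ℂ] Y}
    (h : A ∘L S = T ∘L A) (z : ℂ) : A ∘L shift S z = shift T z ∘L A := by
  ext x
  have := DFunLike.congr_fun h x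
  simp_all [shift]

theorem nullity_le_of_intertwines {S : X →L[ℂ] X} {T : Y →L[ℂ] Y} {A : X →L[ℂ] Y}
    (hA : Function.Injective A) (h : A ∘L S = T ∘L A) : nullity S ≤ nullity T := by
  have hmap : ∀ x ∈ LinearMap.ker (S : X →ₗ[ℂ] X),
      (A : X →ₗ[ℂ] Y) x ∈ LinearMap.ker (T : Y →ₗ[ℂ] Y) := by
    intro x hx
    have hx : S x = 0 := hx
    have := DFunLike.congr_fun h x
    simpa [hx, eq_comm] using this
  refine toENat_rank_le_of_injective ((A : X →ₗ[ℂ] Y).restrict hmap) fun x y hxy => ?_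
  exact Subtype.ext (hA (congrArg Subtype.val hxy))

/-- An intertwining operator with dense range does not increase the codimension of the range,
provided that the second range is closed. -/
theorem defect_le_of_intertwines {S : X →L[ℂ] X} {T : Y →L[ℂ] Y} {A : X →L[ℂ] Y}
    (hA : DenseRange A) (h : A ∘L S = T ∘L A) (hT : IsClosed (Set.range T)) :
    defect T ≤ defect S := by
  by_cases hfin : defect S = ⊤
  · simp [hfin]
  set p := LinearMap.range (S : X →ₗ[ℂ] X)
  set q := LinearMap.range (T : Y →ₗ[ℂ] Y)
  have hfd : FiniteDimensional ℂ (X ⧸ p) := by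
    exact Module.rank_lt_aleph0_iff.1 <| Cardinal.toENat_lt_top.1 (lt_top_iff_ne_top.2 hfin)
  have hle : p ≤ q.comap (A : X →ₗ[ℂ] Y) := by
    rintro _ ⟨x, rfl⟩
    exact ⟨A x, (DFunLike.congr_fun h x).symm⟩
  have : IsClosed (q : Set Y) := hT
  let f := p.mapQ q (A : X →ₗ[ℂ] Y) hle
  -- The range of `f` is finite-dimensional, and `Y ⧸ q` is Hausdorff because `q` is closed. So the
  -- preimage in `Y` is closed and contains the dense range of `A`: it is everything.
  have hcl : IsClosed (Set.range f) := (LinearMap.range f).closed_of_finiteDimensional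
  have hpre : IsClosed (q.mkQ ⁻¹' Set.range f) := hcl.preimage continuous_quot_mk
  have hsurj : Function.Surjective f := by
    intro y
    obtain ⟨y, rfl⟩ := q.mkQ_surjective y
    have hsub : Set.range A ⊆ q.mkQ ⁻¹' Set.range f := by
      rintro _ ⟨x, rfl⟩
      exact ⟨p.mkQ x, rfl⟩
    exact hpre.closure_subset_iff.2 hsub (hA y)
  exact toENat_rank_le_of_surjective f hsurj

/-! ### Eigenvalues and spectra -/

theorem hasEigenvalue_iff_exists (T : X →L[ℂ] X) (z : ℂ) :
    Module.End.HasEigenvalue (T : X →ₗ[ℂ] X) z ↔ ∃ x ≠ 0, shift T z x = 0 := by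
  constructor
  · intro h
    obtain ⟨x, hx⟩ := h.exists_hasEigenvector
    exact ⟨x, hx.2, by simpa [shift, sub_eq_zero] using hx.apply_eq_smul⟩
  · rintro ⟨x, hx, h⟩
    refine Module.End.hasEigenvalue_of_hasEigenvector (x := x)
      ⟨Module.End.mem_eigenspace_iff.2 ?_, hx⟩
    simpa [shift, sub_eq_zero] using h

theorem hasEigenvalue_of_intertwines {S : X →L[ℂ] X} {T : Y →L[ℂ] Y} {A : X →L[ℂ] Y}
    (hA : Function.Injective A) (h : A ∘L S = T ∘L A) {z : ℂ}
    (hz : Module.End.HasEigenvalue (S : X →ₗ[ℂ] X) z) :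
    Module.End.HasEigenvalue (T : Y →ₗ[ℂ] Y) z := by
  rw [hasEigenvalue_iff_exists] at hz ⊢
  obtain ⟨x, hx, hSx⟩ := hz
  refine ⟨A x, (map_ne_zero_iff A hA).2 hx, ?_⟩
  have := DFunLike.congr_fun (shift_intertwines h z) x
  simpa [hSx, eq_comm] using this

theorem hasEigenvalue_directSum (S : X →L[ℂ] X) (T : Y →L[ℂ] Y) (z : ℂ) :
    Module.End.HasEigenvalue (directSum S T : X × Y →ₗ[ℂ] X × Y) z ↔
      Module.End.HasEigenvalue (S : X →ₗ[ℂ] X) z ∨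
        Module.End.HasEigenvalue (T : Y →ₗ[ℂ] Y) z := by
  simp only [hasEigenvalue_iff_exists, shift_directSum]
  constructor
  · rintro ⟨⟨x, y⟩, hxy, h⟩
    have h' : shift S z x = 0 ∧ shift T z y = 0 := Prod.mk.inj h
    by_cases hx : x = 0
    · exact Or.inr ⟨y, fun hy => hxy (by simp [hx, hy]), h'.2⟩
    · exact Or.inl ⟨x, hx, h'.1⟩
  · rintro (⟨x, hx, h⟩ | ⟨y, hy, h⟩)
    · exact ⟨(x, 0), by simp [hx], Prod.ext h (map_zero (shift T z))⟩
    · exact ⟨(0, y), by simp [hy], Prod.ext (map_zero (shift S z)) h⟩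

theorem mem_spectrum_iff (T : X →L[ℂ] X) (z : ℂ) :
    z ∈ spectrum ℂ T ↔ ¬ IsUnit (shift T z) := by
  rw [spectrum.mem_iff, ← IsUnit.neg_iff, neg_sub]
  rfl

theorem mem_spectrum_of_hasEigenvalue {T : X →L[ℂ] X} {z : ℂ}
    (h : Module.End.HasEigenvalue (T : X →ₗ[ℂ] X) z) : z ∈ spectrum ℂ T := by
  obtain ⟨x, hx, hTx⟩ := (hasEigenvalue_iff_exists T z).1 h
  rw [mem_spectrum_iff]
  rintro ⟨u, hu⟩
  apply hx
  have h1 := DFunLike.congr_fun u.inv_mul x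
  simpa [hu, hTx, eq_comm] using h1

theorem mem_spectrum_or_of_mem_directSum {S : X →L[ℂ] X} {T : Y →L[ℂ] Y} {z : ℂ}
    (h : z ∈ spectrum ℂ (directSum S T)) : z ∈ spectrum ℂ S ∨ z ∈ spectrum ℂ T := by
  rw [mem_spectrum_iff, shift_directSum] at h
  simp only [mem_spectrum_iff]
  by_contra! hc
  obtain ⟨⟨u, hu⟩, ⟨v, hv⟩⟩ := hc
  apply h
  rw [← hu, ← hv]
  refine ⟨⟨directSum u v, directSum ↑u⁻¹ ↑v⁻¹, ?_, ?_⟩, rfl⟩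
  · ext p
    exacts [DFunLike.congr_fun u.mul_inv _, by simp [directSum], by simp [directSum],
      DFunLike.congr_fun v.mul_inv _]
  · ext p
    exacts [DFunLike.congr_fun u.inv_mul _, by simp [directSum], by simp [directSum],
      DFunLike.congr_fun v.inv_mul _]

theorem mem_approxPointSpectrum_of_hasEigenvalue {T : X →L[ℂ] X} {z : ℂ}
    (h : Module.End.HasEigenvalue (T : X →ₗ[ℂ] X) z) : z ∈ approxPointSpectrum T := by
  obtain ⟨x, hx, hTx⟩ := (hasEigenvalue_iff_exists T z).1 h
  intro ε hε
  refine ⟨((‖x‖⁻¹ : ℝ) : ℂ) • x, ?_, by simpa [hTx] using hε⟩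
  simp [norm_smul, hx]

theorem approxPointSpectrum_directSum (S : X →L[ℂ] X) (T : Y →L[ℂ] Y) :
    approxPointSpectrum (directSum S T) = approxPointSpectrum S ∪ approxPointSpectrum T := by
  ext z
  constructor
  · intro h
    by_contra hc
    simp only [approxPointSpectrum, Set.mem_union, Set.mem_ofPred_eq, not_or] at hc
    push Not at hc
    obtain ⟨⟨ε, hε, h1⟩, ⟨δ, hδ, h2⟩⟩ := hc
    obtain ⟨⟨x, y⟩, hn, hlt⟩ := h (min ε δ) (lt_min hε hδ)
    rw [shift_directSum] at hlt
    have hlt' : max ‖shift S z x‖ ‖shift T z y‖ < min ε δ := hlt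
    have hn' : max ‖x‖ ‖y‖ = 1 := hn
    rw [max_lt_iff, lt_min_iff, lt_min_iff] at hlt'
    -- In the max norm, a unit vector has a component of norm one.
    rcases max_choice ‖x‖ ‖y‖ with hm | hm <;> rw [hm] at hn'
    · exact (h1 x hn').not_gt hlt'.1.1
    · exact (h2 y hn').not_gt hlt'.2.2
  · rintro (h | h) ε hε
    · obtain ⟨x, hn, hlt⟩ := h ε hε
      refine ⟨(x, 0), by simp [hn], ?_⟩
      rw [shift_directSum]
      simpa [directSum] using hlt
    · obtain ⟨y, hn, hlt⟩ := h ε hε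
      refine ⟨(0, y), by simp [hn], ?_⟩
      rw [shift_directSum]
      simpa [directSum] using hlt

theorem mem_iso_of_subset {A B : Set ℂ} (h : A ⊆ B) {z : ℂ} (hA : z ∈ A) (hB : z ∈ iso B) :
    z ∈ iso A :=
  ⟨hA, fun hd => hB.2 (derivedSet_mono _ _ h hd)⟩

theorem mem_iso_union {A B : Set ℂ} {z : ℂ} (hA : z ∈ iso A) (hB : z ∈ iso B) :
    z ∈ iso (A ∪ B) := by
  refine ⟨Or.inl hA.1, ?_⟩
  rw [derivedSet_union]
  exact not_or.2 ⟨hA.2, hB.2⟩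

/-! ### Quasisimilar operators -/

namespace Quasisimilar

variable {S : X →L[ℂ] X} {T : Y →L[ℂ] Y}

theorem shift (h : Quasisimilar S T) (z : ℂ) : Quasisimilar (shift S z) (shift T z) := by
  obtain ⟨A, B, hA, hB, h1, h2⟩ := h
  exact ⟨A, B, hA, hB, shift_intertwines h1 z, shift_intertwines h2 z⟩

theorem nullity_eq (h : Quasisimilar S T) : nullity S = nullity T := by
  obtain ⟨A, B, hA, hB, h1, h2⟩ := h
  exact le_antisymm (nullity_le_of_intertwines hA.1 h1) (nullity_le_of_intertwines hB.1 h2)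

theorem defect_eq (h : Quasisimilar S T) (hS : IsClosed (Set.range S))
    (hT : IsClosed (Set.range T)) : defect S = defect T := by
  obtain ⟨A, B, hA, hB, h1, h2⟩ := h
  exact le_antisymm (defect_le_of_intertwines hB.2 h2 hS) (defect_le_of_intertwines hA.2 h1 hT)

theorem hasEigenvalue_iff (h : Quasisimilar S T) (z : ℂ) :
    Module.End.HasEigenvalue (S : X →ₗ[ℂ] X) z ↔ Module.End.HasEigenvalue (T : Y →ₗ[ℂ] Y) z := by
  obtain ⟨A, B, hA, hB, h1, h2⟩ := h
  exact ⟨hasEigenvalue_of_intertwines hA.1 h1, hasEigenvalue_of_intertwines hB.1 h2⟩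

/-- For quasisimilar operators the direct sum is upper semi-Weyl only if both summands are: with
closed ranges the nullities and the defects agree, so the index of the sum is twice each index. -/
theorem isUpperSemiWeyl_directSum (h : Quasisimilar S T) :
    IsUpperSemiWeyl (directSum S T) ↔ IsUpperSemiWeyl S ∧ IsUpperSemiWeyl T := by
  simp only [isUpperSemiWeyl_iff, isUpperSemiFredholm_directSum, nullity_directSum,
    defect_directSum]
  constructor
  · rintro ⟨⟨hS, hT⟩, hle⟩
    have hn := h.nullity_eq
    have hd := h.defect_eq hS.1 hT.1
    rw [← hn, ← hd] at hle
    have key : nullity S ≤ defect S := by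
      by_contra! hlt
      exact hle.not_gt (ENat.add_lt_add hlt hlt)
    exact ⟨⟨hS, key⟩, hT, hn ▸ hd ▸ key⟩
  · rintro ⟨⟨hS, h1⟩, hT, h2⟩
    exact ⟨⟨hS, hT⟩, add_le_add h1 h2⟩

end Quasisimilar

/-- Property `(z)` passes to the direct sum of quasisimilar operators, without any assumption on
the single valued extension property. -/
theorem Quasisimilar.propertyZ_directSum {S : X →L[ℂ] X} {T : Y →L[ℂ] Y} (h : Quasisimilar S T)
    (hS : PropertyZ S) (hT : PropertyZ T) : PropertyZ (directSum S T) := by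
  have hweyl : ∀ z, z ∉ upperSemiWeylSpectrum (directSum S T) ↔
      z ∉ upperSemiWeylSpectrum S ∧ z ∉ upperSemiWeylSpectrum T := by
    intro z
    simp only [upperSemiWeylSpectrum, Set.mem_ofPred_eq, not_not, shift_directSum]
    exact (h.shift z).isUpperSemiWeyl_directSum
  ext z
  have hZS := Set.ext_iff.1 hS z
  have hZT := Set.ext_iff.1 hT z
  have hpi : z ∈ piA00 (directSum S T) ↔ z ∈ piA00 S ∧ z ∈ piA00 T := by
    simp only [piA00, finiteEigenvalues, Set.mem_inter_iff, Set.mem_ofPred_eq,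
      hasEigenvalue_directSum, shift_directSum, nullity_directSum, ENat.add_lt_top,
      approxPointSpectrum_directSum, ← h.hasEigenvalue_iff, or_self]
    constructor
    -- Isolation descends to a subset only if the point lies in it; being a common eigenvalue
    -- ensures this.
    · rintro ⟨hiso, he, h1, h2⟩
      exact ⟨⟨mem_iso_of_subset Set.subset_union_left
          (mem_approxPointSpectrum_of_hasEigenvalue he) hiso, he, h1⟩,
        mem_iso_of_subset Set.subset_union_right
          (mem_approxPointSpectrum_of_hasEigenvalue ((h.hasEigenvalue_iff z).1 he)) hiso, he, h2⟩
    · rintro ⟨⟨i1, he, h1⟩, i2, -, h2⟩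
      exact ⟨mem_iso_union i1 i2, he, h1, h2⟩
  rw [hpi, ← hZS, ← hZT, Set.mem_sdiff, Set.mem_sdiff, Set.mem_sdiff, hweyl]
  constructor
  · rintro ⟨hs, h1, h2⟩
    -- Quasisimilarity alone need not preserve spectra; here property $(z)$ supplies an eigenvalue,
    -- which does transfer.
    have hST : z ∈ spectrum ℂ S ↔ z ∈ spectrum ℂ T :=
      ⟨fun hz => mem_spectrum_of_hasEigenvalue
          ((h.hasEigenvalue_iff z).1 (hZS.1 ⟨hz, h1⟩).2.1),
        fun hz => mem_spectrum_of_hasEigenvalue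
          ((h.hasEigenvalue_iff z).2 (hZT.1 ⟨hz, h2⟩).2.1)⟩
    have hz := mem_spectrum_or_of_mem_directSum hs
    rw [← hST, or_self] at hz
    exact ⟨⟨hz, h1⟩, hST.1 hz, h2⟩
  · rintro ⟨⟨hz, h1⟩, -, h2⟩
    exact ⟨mem_spectrum_of_hasEigenvalue ((hasEigenvalue_directSum S T z).2
      (Or.inl (hZS.1 ⟨hz, h1⟩).2.1)), h1, h2⟩

end BanachOp

theorem proposition4p4 {X Y : Type*}
    [NormedAddCommGroup X] [NormedSpace ℂ X] [CompleteSpace X]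
    [NormedAddCommGroup Y] [NormedSpace ℂ Y] [CompleteSpace Y]
    (S : X →L[ℂ] X) (T : Y →L[ℂ] Y)
    (hqs : BanachOp.Quasisimilar S T)
    (hS : BanachOp.PropertyZ S) (hT : BanachOp.PropertyZ T)
    (hsvep : BanachOp.HasSVEP S ∨ BanachOp.HasSVEP T) :
    BanachOp.PropertyZ (BanachOp.directSum S T) := by
  exact hqs.propertyZ_directSum hS hT
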